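/- Let $\Gamma$ be the Euler gamma function and $\psi=\Gamma'/\Gamma$. A positive function $f$ on an interval $I\subseteq\mathbb{R}$ is called logarithmically completely monotonic on $I$ if it has derivatives of all orders on $I$ and $(-1)^k[\ln f(x)]^{(k)}\ge 0$ for all $x\in I$ and all integers $k\ge1$. For $y>-1$ and $\alpha\in\mathbb{R}$ define $h_{\alpha,y}:(-y-1,\infty)\to\mathbb{R}$ by $$h_{\alpha,y}(x)=\begin{cases}\dfrac1{(x+y+1)^\alpha}\left[\dfrac{\Gamma(x+y+1)}{\Gamma(y+1)}\right]^{1/x}, & x\in(-y-1,\infty)\setminus\{0\},\\[2ex] \dfrac1{(y+1)^\alpha}\exp[\psi(y+1)], & x=0.\end{cases}$$ Then, for all $y>-1$ and $\alpha\in\mathbb{R}$: 1. $h_{\alpha,y}$ is logarithmically completely monotonic on $(-y-1,\infty)$ if and only if $\alpha\ge\max\left\{1,\frac1{y+1}\right\}$; 2. if $\alpha\le\min\left\{1,\frac1{2(y+1)}\right\}$, then the reciprocal $1/h_{\alpha,y}$ is logarithmically completely monotonic on $(-y-1,\infty)$; 3. if $1/h_{\alpha,y}$ is logarithmically completely monotonic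 on $(-y-1,\infty)$, then $\alpha\le1$. -/

import Mathlib

open scoped ContDiff

/-- A real function `f` is logarithmically completely monotonic on the interval `I` (positive, since
its logarithm is taken) if it has derivatives of all orders on `I` and
`0 ≤ (-1) ^ k * (log f)^{(k)}` on `I` for every `k = 1, 2, 3, …`. -/
def IsLogCompletelyMonotonicOn (f : ℝ → ℝ) (I : Set ℝ) : Prop :=
  (∀ x ∈ I, 0 < f x) ∧ ContDiffOn ℝ ∞ f I ∧
    ∀ k : ℕ, 1 ≤ k → ∀ x ∈ I,
      0 ≤ (-1 : ℝ) ^ k * iteratedDerivWithin k (fun t => Real.log (f t)) I x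

/-- The psi (digamma) function `ψ = Γ' / Γ` of a real variable. -/
noncomputable def realPsi (x : ℝ) : ℝ :=
  deriv Real.Gamma x / Real.Gamma x

/-- The function `h_{α,y}`; only its values on `(-y-1, ∞)` are meaningful. -/
noncomputable def hFun (α y x : ℝ) : ℝ :=
  if x = 0 then 1 / (y + 1) ^ α * Real.exp (realPsi (y + 1))
  else 1 / (x + y + 1) ^ α * (Real.Gamma (x + y + 1) / Real.Gamma (y + 1)) ^ (1 / x)

open Set Filter Topology

/-! Put `a = y + 1` and `t = x + a`. Then `log h` is minus the difference quotient at `a` of `F t =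
α (t - a) log t - log Γ t`; the point `x = 0` is its removable singularity. A difference quotient
averages `F'` over the segment from `a` to `t`, so its `k`-th derivative inherits a constant sign of
`F^{(k+1)}` (`iteratedDeriv_dslope_nonneg`).

Since `F'' = α (1/t + a/t²) - ψ'`, sufficiency reduces to complete monotonicity of `1/t + 1/t² - ψ'`
and `ψ' - 1/t - 1/(2t²)`. Both are proved for approximants of `log Γ`, where the differences are
explicit sums of products of `1/(t + c)`. Signs of derivatives survive pointwise limits because they
are equivalent to signs of iterated differences (`iterDiffNonneg_iff`).

For necessity only `k = 1` is used: `log h` is monotone, while `log h / log t` tends to `1 - α`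
along the integers and to `1/a - α` at `0+`. -/

/-! ### Derivative signs under pointwise limits -/

/-- All iterated forward differences of order `n` of `f` are nonnegative on `(0, ∞)`. -/
def IterDiffNonneg : ℕ → (ℝ → ℝ) → Prop
  | 0, f => ∀ x, 0 < x → 0 ≤ f x
  | n + 1, f => ∀ δ, 0 < δ → IterDiffNonneg n (fun x => f (x + δ) - f x)

theorem IterDiffNonneg.of_tendsto {n : ℕ} {F : ℕ → ℝ → ℝ} {f : ℝ → ℝ}
    (hF : ∀ i, IterDiffNonneg n (F i))
    (hlim : ∀ x, 0 < x → Tendsto (fun i => F i x) atTop (𝓝 (f x))) : IterDiffNonneg n f := by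
  induction n generalizing F f with
  | zero => exact fun x hx => ge_of_tendsto' (hlim x hx) fun i => hF i x hx
  | succ n ih =>
    exact fun δ hδ => ih (fun i => hF i δ hδ) fun x hx =>
      (hlim (x + δ) (by positivity)).sub (hlim x hx)

theorem AnalyticOnNhd.hasDerivAt_iteratedDeriv {f : ℝ → ℝ} {s : Set ℝ} (hf : AnalyticOnNhd ℝ f s)
    (n : ℕ) {x : ℝ} (hx : x ∈ s) :
    HasDerivAt (iteratedDeriv n f) (iteratedDeriv (n + 1) f x) x := by
  rw [iteratedDeriv_succ]
  apply DifferentiableAt.hasDerivAt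
  rw [iteratedDeriv_eq_iterate]
  exact (hf.iterated_deriv n x hx).differentiableAt

theorem AnalyticOnNhd.comp_add_sub {f : ℝ → ℝ} (hf : AnalyticOnNhd ℝ f (Ioi 0)) {δ : ℝ}
    (hδ : 0 < δ) : AnalyticOnNhd ℝ (fun x => f (x + δ) - f x) (Ioi 0) := by
  intro x hx
  have hx' : (0 : ℝ) < x := hx
  refine AnalyticAt.sub ?_ (hf x hx)
  exact AnalyticAt.fun_comp (hf (x + δ) (show 0 < x + δ by positivity))
    (analyticAt_id.add analyticAt_const)

theorem iteratedDeriv_comp_add_sub {f : ℝ → ℝ} (hf : AnalyticOnNhd ℝ f (Ioi 0)) (n : ℕ) {δ x : ℝ}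
    (hδ : 0 < δ) (hx : 0 < x) :
    iteratedDeriv n (fun x => f (x + δ) - f x) x
      = iteratedDeriv n f (x + δ) - iteratedDeriv n f x := by
  have h : AnalyticAt ℝ (fun x => f (x + δ)) x :=
    AnalyticAt.fun_comp (hf (x + δ) (show 0 < x + δ by positivity))
      (analyticAt_id.add analyticAt_const)
  rw [iteratedDeriv_fun_sub h.contDiffAt (hf x hx).contDiffAt, iteratedDeriv_comp_add_const]

/-- Induction on `n`: differencing commutes with `iteratedDeriv n`, so nonnegative differences for
every `δ` mean that the `n`-th derivative is monotone. -/
theorem iterDiffNonneg_iff {n : ℕ} {f : ℝ → ℝ} (hf : AnalyticOnNhd ℝ f (Ioi 0)) :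
    IterDiffNonneg n f ↔ ∀ x, 0 < x → 0 ≤ iteratedDeriv n f x := by
  induction n generalizing f with
  | zero => simp [IterDiffNonneg]
  | succ n ih =>
    have hd : ∀ x ∈ Ioi (0 : ℝ), HasDerivAt (iteratedDeriv n f) (iteratedDeriv (n + 1) f x) x :=
      fun x hx => hf.hasDerivAt_iteratedDeriv n hx
    have key : IterDiffNonneg (n + 1) f ↔ MonotoneOn (iteratedDeriv n f) (Ioi 0) := by
      constructor
      · intro h x hx y hy hxy
        rcases hxy.eq_or_lt with rfl | hxy
        · exact le_rfl
        · have h1 := (ih (hf.comp_add_sub (sub_pos.2 hxy))).1 (h _ (sub_pos.2 hxy)) x hx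
          rw [iteratedDeriv_comp_add_sub hf n (sub_pos.2 hxy) hx] at h1
          simpa using h1
      · intro h δ hδ
        refine (ih (hf.comp_add_sub hδ)).2 fun x hx => ?_
        rw [iteratedDeriv_comp_add_sub hf n hδ hx, sub_nonneg]
        exact h hx (show 0 < x + δ by positivity) (by linarith)
    rw [key]
    constructor
    · intro h x hx
      rw [← (hd x hx).deriv, ← derivWithin_of_isOpen isOpen_Ioi hx]
      exact h.derivWithin_nonneg
    · intro h
      refine monotoneOn_of_deriv_nonneg (convex_Ioi 0)
        (fun x hx => (hd x hx).continuousAt.continuousWithinAt)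
        (fun x hx => ?_) (fun x hx => ?_)
      · rw [interior_Ioi] at hx
        exact (hd x hx).differentiableAt.differentiableWithinAt
      · rw [interior_Ioi] at hx
        rw [(hd x hx).deriv]
        exact h x hx

/-- The sign of the `n`-th derivative is inherited by pointwise limits of analytic functions. -/
theorem iteratedDeriv_nonneg_of_tendsto {n : ℕ} {c : ℝ} {F : ℕ → ℝ → ℝ} {f : ℝ → ℝ}
    (hF : ∀ i, AnalyticOnNhd ℝ (F i) (Ioi 0)) (hf : AnalyticOnNhd ℝ f (Ioi 0))
    (hlim : ∀ x, 0 < x → Tendsto (fun i => F i x) atTop (𝓝 (f x)))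
    (hn : ∀ i x, 0 < x → 0 ≤ c * iteratedDeriv n (F i) x) {x : ℝ} (hx : 0 < x) :
    0 ≤ c * iteratedDeriv n f x := by
  have hc : ∀ {g : ℝ → ℝ}, AnalyticOnNhd ℝ g (Ioi 0) →
      AnalyticOnNhd ℝ (fun x => c * g x) (Ioi 0) := fun hg x hx => analyticAt_const.mul (hg x hx)
  rw [← iteratedDeriv_const_mul_field]
  refine (iterDiffNonneg_iff (hc hf)).1 (IterDiffNonneg.of_tendsto (F := fun i x => c * F i x)
    (fun i => (iterDiffNonneg_iff (hc (hF i))).2 fun x hx => ?_)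
    fun x hx => (hlim x hx).const_mul c) x hx
  rw [iteratedDeriv_const_mul_field]
  exact hn i x hx

/-! ### Completely monotonic functions -/

/-- Completely monotonic (analytic) functions on `(0, ∞)`. -/
def IsCompletelyMonotonic (f : ℝ → ℝ) : Prop :=
  AnalyticOnNhd ℝ f (Ioi 0) ∧ ∀ n : ℕ, ∀ x, 0 < x → 0 ≤ (-1 : ℝ) ^ n * iteratedDeriv n f x

namespace IsCompletelyMonotonic

variable {f g : ℝ → ℝ}

theorem congr (hf : IsCompletelyMonotonic f) (h : EqOn f g (Ioi 0)) :
    IsCompletelyMonotonic g := by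
  refine ⟨hf.1.congr isOpen_Ioi h, fun n x hx => ?_⟩
  rw [← (h.eventuallyEq_of_mem (Ioi_mem_nhds hx)).iteratedDeriv_eq n]
  exact hf.2 n x hx

theorem add (hf : IsCompletelyMonotonic f) (hg : IsCompletelyMonotonic g) :
    IsCompletelyMonotonic (fun x => f x + g x) := by
  refine ⟨fun x hx => (hf.1 x hx).add (hg.1 x hx), fun n x hx => ?_⟩
  rw [iteratedDeriv_fun_add (hf.1 x hx).contDiffAt (hg.1 x hx).contDiffAt, mul_add]
  exact add_nonneg (hf.2 n x hx) (hg.2 n x hx)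

theorem const_mul (hf : IsCompletelyMonotonic f) {c : ℝ} (hc : 0 ≤ c) :
    IsCompletelyMonotonic (fun x => c * f x) := by
  refine ⟨fun x hx => analyticAt_const.mul (hf.1 x hx), fun n x hx => ?_⟩
  rw [iteratedDeriv_const_mul_field, mul_left_comm]
  exact mul_nonneg hc (hf.2 n x hx)

theorem sum {ι : Type*} {s : Finset ι} {F : ι → ℝ → ℝ} (hF : ∀ i, IsCompletelyMonotonic (F i)) :
    IsCompletelyMonotonic (fun x => ∑ i ∈ s, F i x) := by
  refine ⟨fun x hx => Finset.analyticAt_fun_sum _ fun i _ => (hF i).1 x hx, fun n x hx => ?_⟩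
  rw [iteratedDeriv_fun_sum fun i _ => ((hF i).1 x hx).contDiffAt, Finset.mul_sum]
  exact Finset.sum_nonneg fun i _ => (hF i).2 n x hx

theorem mul (hf : IsCompletelyMonotonic f) (hg : IsCompletelyMonotonic g) :
    IsCompletelyMonotonic (fun x => f x * g x) := by
  refine ⟨fun x hx => (hf.1 x hx).mul (hg.1 x hx), fun n x hx => ?_⟩
  rw [iteratedDeriv_fun_mul (hf.1 x hx).contDiffAt (hg.1 x hx).contDiffAt, Finset.mul_sum]
  refine Finset.sum_nonneg fun i hi => ?_
  have hin : i ≤ n := Nat.lt_succ_iff.1 (Finset.mem_range.1 hi)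
  have : (-1 : ℝ) ^ n = (-1) ^ i * (-1) ^ (n - i) := by rw [← pow_add, Nat.add_sub_cancel' hin]
  rw [this]
  calc (0 : ℝ) ≤ n.choose i * (((-1) ^ i * iteratedDeriv i f x)
        * ((-1) ^ (n - i) * iteratedDeriv (n - i) g x)) := by
        have := hf.2 i x hx
        have := hg.2 (n - i) x hx
        positivity
    _ = _ := by ring

theorem inv_add_const {c : ℝ} (hc : 0 ≤ c) : IsCompletelyMonotonic (fun x => (x + c)⁻¹) := by
  refine ⟨fun x hx => ?_, fun n x hx => ?_⟩
  · have hx' : 0 < x := hx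
    exact (analyticAt_id.add analyticAt_const).inv (by simp; positivity)
  · have := congrFun (iteratedDeriv_comp_add_const n (fun z : ℝ => z⁻¹) c) x
    rw [this]
    have h2 := iter_deriv_inv (𝕜 := ℝ) n (x + c)
    rw [iteratedDeriv_eq_iterate]
    simp only [h2]
    rw [← mul_assoc, ← mul_assoc, ← pow_add, Even.neg_one_pow ⟨n, rfl⟩, one_mul]
    positivity

end IsCompletelyMonotonic

theorem iteratedDeriv_add_two_eq {f f' f'' : ℝ → ℝ} (h1 : ∀ x, 0 < x → HasDerivAt f (f' x) x)
    (h2 : ∀ x, 0 < x → HasDerivAt f' (f'' x) x) (k : ℕ) {x : ℝ} (hx : 0 < x) :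
    iteratedDeriv (k + 2) f x = iteratedDeriv k f'' x := by
  have e1 : EqOn (deriv f) f' (Ioi 0) := fun x hx => (h1 x hx).deriv
  have e2 : EqOn (deriv f') f'' (Ioi 0) := fun x hx => (h2 x hx).deriv
  rw [iteratedDeriv_succ', (e1.eventuallyEq_of_mem (Ioi_mem_nhds hx)).iteratedDeriv_eq,
    iteratedDeriv_succ', (e2.eventuallyEq_of_mem (Ioi_mem_nhds hx)).iteratedDeriv_eq]

/-! ### Derivatives of difference quotients -/

theorem AnalyticAt.dslope {f : ℝ → ℝ} {a t : ℝ} (ha : AnalyticAt ℝ f a) (ht : AnalyticAt ℝ f t) :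
    AnalyticAt ℝ (dslope f a) t := by
  rcases eq_or_ne t a with rfl | hta
  · obtain ⟨p, hp⟩ := ha
    exact hp.has_fpower_series_dslope_fslope.analyticAt
  · have : AnalyticAt ℝ (fun x => (x - a)⁻¹ * (f x - f a)) t :=
      ((analyticAt_id.sub analyticAt_const).inv (sub_ne_zero.2 hta)).mul (ht.sub analyticAt_const)
    refine this.congr ?_
    filter_upwards [isOpen_ne.mem_nhds hta] with x hx
    rw [dslope_of_ne _ hx, slope_def_field, div_eq_inv_mul]

/-- This is the Leibniz rule for `(t - a) * dslope f a t = f t - f a`. -/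
theorem sub_mul_iteratedDeriv_dslope {f : ℝ → ℝ} (hf : AnalyticOnNhd ℝ f (Ioi 0)) {a : ℝ}
    (ha : 0 < a) (k : ℕ) {t : ℝ} (ht : 0 < t) :
    (t - a) * iteratedDeriv (k + 1) (dslope f a) t + (k + 1) * iteratedDeriv k (dslope f a) t
      = iteratedDeriv (k + 1) f t := by
  have hu : AnalyticOnNhd ℝ (dslope f a) (Ioi 0) := fun t ht => (hf a ha).dslope (hf t ht)
  have hsub : ∀ t : ℝ, HasDerivAt (fun t => t - a) 1 t := fun t => (hasDerivAt_id t).sub_const a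
  induction k generalizing t with
  | zero =>
    have h0 := hu.hasDerivAt_iteratedDeriv 0 ht
    have h1 := (hsub t).mul h0
    have h2 := (hf.hasDerivAt_iteratedDeriv 0 ht).sub_const (f a)
    simp only [iteratedDeriv_zero] at h1 h2
    have h3 : (fun t => t - a) * dslope f a = fun t => f t - f a := by
      ext t
      exact sub_smul_dslope f a t
    rw [h3] at h1
    have := h1.unique h2
    simp only [iteratedDeriv_zero]
    push_cast
    linarith
  | succ k ih =>
    have h1 := ((hsub t).mul (hu.hasDerivAt_iteratedDeriv (k + 1) ht)).add
      ((hu.hasDerivAt_iteratedDeriv k ht).const_mul ((k : ℝ) + 1))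
    have h2 := hf.hasDerivAt_iteratedDeriv (k + 1) ht
    have h3 := h1.congr_of_eventuallyEq (f₁ := iteratedDeriv (k + 1) f) (by
      filter_upwards [Ioi_mem_nhds ht] with s hs
      simpa using (ih hs).symm)
    have := h3.unique h2
    push_cast
    linarith

/-- The difference quotient of `f` at `a` inherits the sign of the next derivative of `f`. -/
theorem iteratedDeriv_dslope_nonneg {f : ℝ → ℝ} (hf : AnalyticOnNhd ℝ f (Ioi 0)) {a c : ℝ}
    (ha : 0 < a) {k : ℕ} (hk : ∀ t, 0 < t → 0 ≤ c * iteratedDeriv (k + 1) f t) {t : ℝ}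
    (ht : 0 < t) : 0 ≤ c * iteratedDeriv k (dslope f a) t := by
  have hu : AnalyticOnNhd ℝ (dslope f a) (Ioi 0) := fun t ht => (hf a ha).dslope (hf t ht)
  have hrec := fun {t : ℝ} (ht : 0 < t) => sub_mul_iteratedDeriv_dslope hf ha k ht
  rcases lt_trichotomy t a with h | h | h
  -- By the recurrence, the weight `(a - s) ^ (k + 1)` turns the derivative into a multiple of
  -- `f^{(k+1)}`; the product vanishes at `s = a`, so monotonicity fixes its sign at `t`.
  · have hd : ∀ s ∈ Icc t a, HasDerivAt
        (fun s => (a - s) ^ (k + 1) * (c * iteratedDeriv k (dslope f a) s))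
        (-((a - s) ^ k * (c * iteratedDeriv (k + 1) f s))) s := by
      intro s hs
      have hs0 : 0 < s := ht.trans_le hs.1
      have h1 := (((hasDerivAt_id s).const_sub a).pow (k + 1)).mul
        ((hu.hasDerivAt_iteratedDeriv k hs0).const_mul c)
      refine h1.congr_deriv ?_
      rw [← hrec hs0]
      simp
      ring
    have hanti : AntitoneOn
        (fun s => (a - s) ^ (k + 1) * (c * iteratedDeriv k (dslope f a) s)) (Icc t a) := by
      refine antitoneOn_of_deriv_nonpos (convex_Icc t a)
        (fun s hs => (hd s hs).continuousAt.continuousWithinAt)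
        (fun s hs => (hd s (interior_subset hs)).differentiableAt.differentiableWithinAt)
        (fun s hs => ?_)
      have hs' := interior_subset hs
      rw [(hd s hs').deriv, neg_nonpos]
      exact mul_nonneg (pow_nonneg (sub_nonneg.2 hs'.2) _) (hk s (ht.trans_le hs'.1))
    have := hanti (left_mem_Icc.2 h.le) (right_mem_Icc.2 h.le) h.le
    simp only [sub_self, ne_eq, Nat.succ_ne_zero, not_false_eq_true, zero_pow, zero_mul] at this
    exact nonneg_of_mul_nonneg_right this (pow_pos (sub_pos.2 h) _)
  · subst h
    have h1 := hrec ht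
    have h2 := hk t ht
    rw [← h1, sub_self, zero_mul, zero_add, mul_left_comm] at h2
    exact nonneg_of_mul_nonneg_right h2 (by positivity)
  · have hd : ∀ s ∈ Icc a t, HasDerivAt
        (fun s => (s - a) ^ (k + 1) * (c * iteratedDeriv k (dslope f a) s))
        ((s - a) ^ k * (c * iteratedDeriv (k + 1) f s)) s := by
      intro s hs
      have hs0 : 0 < s := ha.trans_le hs.1
      have h1 := (((hasDerivAt_id s).sub_const a).pow (k + 1)).mul
        ((hu.hasDerivAt_iteratedDeriv k hs0).const_mul c)
      refine h1.congr_deriv ?_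
      rw [← hrec hs0]
      simp
      ring
    have hmono : MonotoneOn
        (fun s => (s - a) ^ (k + 1) * (c * iteratedDeriv k (dslope f a) s)) (Icc a t) := by
      refine monotoneOn_of_deriv_nonneg (convex_Icc a t)
        (fun s hs => (hd s hs).continuousAt.continuousWithinAt)
        (fun s hs => (hd s (interior_subset hs)).differentiableAt.differentiableWithinAt)
        (fun s hs => ?_)
      have hs' := interior_subset hs
      rw [(hd s hs').deriv]
      exact mul_nonneg (pow_nonneg (sub_nonneg.2 hs'.1) _) (hk s (ha.trans_le hs'.1))
    have := hmono (left_mem_Icc.2 h.le) (right_mem_Icc.2 h.le) h.le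
    simp only [sub_self, ne_eq, Nat.succ_ne_zero, not_false_eq_true, zero_pow, zero_mul] at this
    exact nonneg_of_mul_nonneg_right this (pow_pos (sub_pos.2 h) _)

/-! ### Approximation of log Γ -/

theorem analyticOnNhd_log_Gamma :
    AnalyticOnNhd ℝ (fun t => Real.log (Real.Gamma t)) (Ioi 0) := by
  intro t ht
  have hC : AnalyticAt ℂ Complex.Gamma (t : ℂ) := by
    have hopen : IsOpen {z : ℂ | 0 < z.re} := isOpen_lt continuous_const Complex.continuous_re
    refine DifferentiableOn.analyticAt (s := {z : ℂ | 0 < z.re}) (fun z hz => ?_)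
      (hopen.mem_nhds (by simpa using ht))
    refine (Complex.differentiableAt_Gamma z fun m hm => ?_).differentiableWithinAt
    have hz' : 0 < z.re := hz
    rw [hm] at hz'
    have : (0 : ℝ) ≤ m := Nat.cast_nonneg m
    simp at hz'
    linarith
  exact AnalyticAt.log hC.re_ofReal (Real.Gamma_pos_of_pos ht)

/-- The Euler sequence for `log Γ`, corrected by a term tending to zero so that its second
derivative compares with `1 / t` exactly. -/
noncomputable def correctedLogGammaSeq (N : ℕ) (t : ℝ) : ℝ :=
  Real.BohrMollerup.logGammaSeq t N + ((t + N) * (Real.log (t + N) - Real.log N) - t)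

theorem tendsto_correctedLogGammaSeq {t : ℝ} (ht : 0 < t) :
    Tendsto (fun N => correctedLogGammaSeq N t) atTop (𝓝 (Real.log (Real.Gamma t))) := by
  -- With `u = (t + N) / N`, the bounds `1 - 1/u ≤ log u ≤ u - 1` squeeze the correction between `0`
  -- and `t² / N`.
  have h0 : Tendsto (fun N : ℕ => (t + N) * (Real.log (t + N) - Real.log N) - t) atTop (𝓝 0) := by
    refine tendsto_of_tendsto_of_tendsto_of_le_of_le' tendsto_const_nhds
      (tendsto_const_div_atTop_nhds_zero_nat (t ^ 2)) ?_ ?_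
    · filter_upwards [eventually_gt_atTop 0] with N hN
      have hN' : (0 : ℝ) < N := Nat.cast_pos.2 hN
      have h1 := Real.one_sub_inv_le_log_of_pos (x := (t + N) / N) (by positivity)
      rw [Real.log_div (by positivity) hN'.ne'] at h1
      have h2 := mul_le_mul_of_nonneg_left h1 (show 0 ≤ t + N by positivity)
      have h3 : (t + N) * (1 - ((t + N) / N)⁻¹) = t := by field_simp; ring
      linarith
    · filter_upwards [eventually_gt_atTop 0] with N hN
      have hN' : (0 : ℝ) < N := Nat.cast_pos.2 hN
      have h1 := Real.log_le_sub_one_of_pos (x := (t + N) / N) (by positivity)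
      rw [Real.log_div (by positivity) hN'.ne'] at h1
      have h2 := mul_le_mul_of_nonneg_left h1 (show 0 ≤ t + N by positivity)
      have h3 : (t + N) * ((t + N) / N - 1) = t ^ 2 / N + t := by field_simp; ring
      linarith
  simpa [correctedLogGammaSeq] using (Real.BohrMollerup.tendsto_log_gamma ht).add h0

theorem analyticOnNhd_correctedLogGammaSeq (N : ℕ) :
    AnalyticOnNhd ℝ (correctedLogGammaSeq N) (Ioi 0) := by
  intro t ht
  have ht' : 0 < t := ht
  have hlog : ∀ m : ℕ, AnalyticAt ℝ (fun t : ℝ => Real.log (t + m)) t := fun m =>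
    AnalyticAt.log (analyticAt_id.add analyticAt_const) (show 0 < t + m by positivity)
  unfold correctedLogGammaSeq Real.BohrMollerup.logGammaSeq
  exact (((analyticAt_id.mul analyticAt_const).add analyticAt_const).sub
    (Finset.analyticAt_fun_sum _ fun m _ => hlog m)).add
    (((analyticAt_id.add analyticAt_const).mul ((hlog N).sub analyticAt_const)).sub analyticAt_id)

theorem hasDerivAt_correctedLogGammaSeq (N : ℕ) {t : ℝ} (ht : 0 < t) :
    HasDerivAt (correctedLogGammaSeq N)
      (Real.log (t + N) - ∑ m ∈ Finset.range (N + 1), (t + m)⁻¹) t := by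
  have hadd : ∀ m : ℕ, HasDerivAt (fun t : ℝ => t + m) 1 t := fun m =>
    (hasDerivAt_id t).add_const (m : ℝ)
  have hlog : ∀ m : ℕ, HasDerivAt (fun t : ℝ => Real.log (t + m)) (t + m)⁻¹ t := fun m => by
    simpa using (hadd m).log (by positivity)
  have h := ((((hasDerivAt_id t).mul_const (Real.log N)).add_const (Real.log N.factorial)).sub
    (HasDerivAt.fun_sum fun m (_ : m ∈ Finset.range (N + 1)) => hlog m)).add
    (((hadd N).mul ((hlog N).sub_const (Real.log N))).sub (hasDerivAt_id t))
  refine h.congr_deriv ?_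
  have : t + N ≠ 0 := by positivity
  rw [mul_inv_cancel₀ this]
  ring

theorem hasDerivAt_deriv_correctedLogGammaSeq (N : ℕ) {t : ℝ} (ht : 0 < t) :
    HasDerivAt (fun t : ℝ => Real.log (t + N) - ∑ m ∈ Finset.range (N + 1), (t + m)⁻¹)
      ((t + N)⁻¹ + ∑ m ∈ Finset.range (N + 1), ((t + m) ^ 2)⁻¹) t := by
  have hadd : ∀ m : ℕ, HasDerivAt (fun t : ℝ => t + m) 1 t := fun m =>
    (hasDerivAt_id t).add_const (m : ℝ)
  have h := ((hadd N).log (by positivity)).sub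
    (HasDerivAt.fun_sum fun m (_ : m ∈ Finset.range (N + 1)) => (hadd m).fun_inv (by positivity))
  refine h.congr_deriv ?_
  simp [neg_div, Finset.sum_neg_distrib]

/-! ### Explicit remainders for the trigamma approximants -/

/-- The summand is the error of the right-endpoint rule for `∫ 1/x²` over `[t + m, t + m + 1]`. -/
theorem sum_inv_sq_upper (N : ℕ) {t : ℝ} (ht : 0 < t) :
    t⁻¹ + (t ^ 2)⁻¹ - ((t + N)⁻¹ + ∑ m ∈ Finset.range (N + 1), ((t + m) ^ 2)⁻¹)
      = ∑ m ∈ Finset.range N, (t + m)⁻¹ * ((t + (m + 1))⁻¹ * (t + (m + 1))⁻¹) := by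
  induction N with
  | zero => simp
  | succ N ih =>
    have e1 := Finset.sum_range_succ (fun m : ℕ => ((t + m) ^ 2)⁻¹) (N + 1)
    have e2 := Finset.sum_range_succ
      (fun m : ℕ => (t + m)⁻¹ * ((t + (m + 1))⁻¹ * (t + (m + 1))⁻¹)) N
    have step : (t + N)⁻¹ - (t + (N + 1))⁻¹ - ((t + (N + 1)) ^ 2)⁻¹
        = (t + N)⁻¹ * ((t + (N + 1))⁻¹ * (t + (N + 1))⁻¹) := by
      field_simp
      ring
    push_cast at *
    linarith

/-- Here the trapezoidal rule is used: with `P = 1/p`, `Q = 1/(p + 1)` one has `P - Q = PQ`, so its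
error `(P² + Q²)/2 - PQ` equals `(P - Q)²/2 = P²Q²/2`. -/
theorem sum_inv_sq_lower (N : ℕ) {t : ℝ} (ht : 0 < t) :
    (t + N)⁻¹ + ∑ m ∈ Finset.range (N + 1), ((t + m) ^ 2)⁻¹ - (t⁻¹ + 1 / 2 * (t ^ 2)⁻¹)
      = 1 / 2 * ((t + N)⁻¹ * (t + N)⁻¹) + 1 / 2 * ∑ m ∈ Finset.range N,
        ((t + m)⁻¹ * (t + m)⁻¹) * ((t + (m + 1))⁻¹ * (t + (m + 1))⁻¹) := by
  induction N with
  | zero => simp; field_simp; ring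
  | succ N ih =>
    have e1 := Finset.sum_range_succ (fun m : ℕ => ((t + m) ^ 2)⁻¹) (N + 1)
    have e2 := Finset.sum_range_succ
      (fun m : ℕ => ((t + m)⁻¹ * (t + m)⁻¹) * ((t + (m + 1))⁻¹ * (t + (m + 1))⁻¹)) N
    have step : (t + (N + 1))⁻¹ - (t + N)⁻¹ + ((t + (N + 1)) ^ 2)⁻¹
        = 1 / 2 * ((t + (N + 1))⁻¹ * (t + (N + 1))⁻¹) - 1 / 2 * ((t + N)⁻¹ * (t + N)⁻¹)
          + 1 / 2 * (((t + N)⁻¹ * (t + N)⁻¹) * ((t + (N + 1))⁻¹ * (t + (N + 1))⁻¹)) := by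
      field_simp
      ring
    push_cast at *
    linarith

/-! ### Second derivative of the defect -/

/-- The function whose difference quotient at `a = y + 1` is `-log h_{α,y}`. -/
noncomputable def logGammaDefect (α a t : ℝ) : ℝ :=
  α * ((t - a) * Real.log t) - Real.log (Real.Gamma t)

theorem analyticAt_sub_mul_log (α a : ℝ) {t : ℝ} (ht : 0 < t) :
    AnalyticAt ℝ (fun t => α * ((t - a) * Real.log t)) t :=
  analyticAt_const.mul ((analyticAt_id.sub analyticAt_const).mul (analyticAt_id.log ht))

theorem analyticOnNhd_logGammaDefect (α a : ℝ) :
    AnalyticOnNhd ℝ (logGammaDefect α a) (Ioi 0) := fun t ht =>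
  (analyticAt_sub_mul_log α a ht).sub (analyticOnNhd_log_Gamma t ht)

theorem iteratedDeriv_add_two_approx (α a : ℝ) (N k : ℕ) {t : ℝ} (ht : 0 < t) :
    iteratedDeriv (k + 2) (fun t => α * ((t - a) * Real.log t) - correctedLogGammaSeq N t) t
      = iteratedDeriv k (fun t : ℝ => α * (t⁻¹ + a * (t ^ 2)⁻¹)
        - ((t + N)⁻¹ + ∑ m ∈ Finset.range (N + 1), ((t + m) ^ 2)⁻¹)) t := by
  refine iteratedDeriv_add_two_eq
    (f' := fun t => α * (Real.log t + 1 - a * t⁻¹)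
      - (Real.log (t + N) - ∑ m ∈ Finset.range (N + 1), (t + m)⁻¹))
    (fun t ht => ?_) (fun t ht => ?_) k ht
  · refine HasDerivAt.sub (((((hasDerivAt_id t).sub_const a).mul
      (Real.hasDerivAt_log ht.ne')).const_mul α).congr_deriv ?_)
      (hasDerivAt_correctedLogGammaSeq N ht)
    simp only [id_eq, one_mul]
    linear_combination α * mul_inv_cancel₀ ht.ne'
  · refine HasDerivAt.sub (((((Real.hasDerivAt_log ht.ne').add_const 1).sub
      ((hasDerivAt_inv ht.ne').const_mul a)).const_mul α).congr_deriv ?_)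
      (hasDerivAt_deriv_correctedLogGammaSeq N ht)
    ring

/-- The hypothesis concerns `c` times the second derivative of each approximant; `c = 1` and `c =
-1` serve the two directions. -/
theorem neg_one_pow_mul_iteratedDeriv_logGammaDefect_nonneg {α a : ℝ} (c : ℝ)
    (h : ∀ N : ℕ, IsCompletelyMonotonic (fun t : ℝ => c * (α * (t⁻¹ + a * (t ^ 2)⁻¹)
        - ((t + N)⁻¹ + ∑ m ∈ Finset.range (N + 1), ((t + m) ^ 2)⁻¹))))
    (k : ℕ) {t : ℝ} (ht : 0 < t) :
    0 ≤ ((-1) ^ k * c) * iteratedDeriv (k + 2) (logGammaDefect α a) t := by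
  refine iteratedDeriv_nonneg_of_tendsto
    (F := fun N t => α * ((t - a) * Real.log t) - correctedLogGammaSeq N t)
    (fun N t ht => (analyticAt_sub_mul_log α a ht).sub (analyticOnNhd_correctedLogGammaSeq N t ht))
    (analyticOnNhd_logGammaDefect α a)
    (fun t ht => tendsto_const_nhds.sub (tendsto_correctedLogGammaSeq ht))
    (fun N t ht => ?_) ht
  rw [iteratedDeriv_add_two_approx α a N k ht, mul_assoc, ← iteratedDeriv_const_mul_field]
  exact (h N).2 k t ht

theorem isCompletelyMonotonic_inv : IsCompletelyMonotonic (fun t => t⁻¹) := by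
  simpa using IsCompletelyMonotonic.inv_add_const le_rfl

/-- The function is the remainder sum plus `(α - 1)/t + (αa - 1)/t²`, which is where both conditions
on `α` come from. -/
theorem isCompletelyMonotonic_upper {α a : ℝ} (h1 : 1 ≤ α) (h2 : 1 ≤ α * a) (N : ℕ) :
    IsCompletelyMonotonic (fun t : ℝ => 1 * (α * (t⁻¹ + a * (t ^ 2)⁻¹)
        - ((t + N)⁻¹ + ∑ m ∈ Finset.range (N + 1), ((t + m) ^ 2)⁻¹))) := by
  have hs : IsCompletelyMonotonic (fun t : ℝ => ∑ m ∈ Finset.range N,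
      (t + (m : ℝ))⁻¹ * ((t + ((m : ℝ) + 1))⁻¹ * (t + ((m : ℝ) + 1))⁻¹)) :=
    .sum fun m => (IsCompletelyMonotonic.inv_add_const (by positivity)).mul
      ((IsCompletelyMonotonic.inv_add_const (by positivity)).mul
        (IsCompletelyMonotonic.inv_add_const (by positivity)))
  refine ((hs.add (isCompletelyMonotonic_inv.const_mul (sub_nonneg.2 h1))).add
    ((isCompletelyMonotonic_inv.mul isCompletelyMonotonic_inv).const_mul
      (sub_nonneg.2 h2))).congr fun t ht => ?_
  simp only [← sum_inv_sq_upper N ht]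
  ring

/-- The extra terms are now `(1 - α)/t + (1/2 - αa)/t²`. -/
theorem isCompletelyMonotonic_lower {α a : ℝ} (h1 : α ≤ 1) (h2 : α * a ≤ 1 / 2) (N : ℕ) :
    IsCompletelyMonotonic (fun t : ℝ => (-1) * (α * (t⁻¹ + a * (t ^ 2)⁻¹)
        - ((t + N)⁻¹ + ∑ m ∈ Finset.range (N + 1), ((t + m) ^ 2)⁻¹))) := by
  have hi : ∀ {c : ℝ}, 0 ≤ c → IsCompletelyMonotonic (fun t => (t + c)⁻¹ * (t + c)⁻¹) :=
    fun hc => (IsCompletelyMonotonic.inv_add_const hc).mul (IsCompletelyMonotonic.inv_add_const hc)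
  have hs : IsCompletelyMonotonic (fun t : ℝ => ∑ m ∈ Finset.range N,
      ((t + (m : ℝ))⁻¹ * (t + (m : ℝ))⁻¹) * ((t + ((m : ℝ) + 1))⁻¹ * (t + ((m : ℝ) + 1))⁻¹)) :=
    .sum fun m => (hi (by positivity)).mul (hi (by positivity))
  have hhalf : (0 : ℝ) ≤ 1 / 2 := by norm_num
  refine (((((hi (Nat.cast_nonneg N)).const_mul hhalf).add (hs.const_mul hhalf)).add
    (isCompletelyMonotonic_inv.const_mul (sub_nonneg.2 h1))).add
    ((isCompletelyMonotonic_inv.mul isCompletelyMonotonic_inv).const_mul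
      (sub_nonneg.2 h2))).congr fun t ht => ?_
  simp only [← sum_inv_sq_lower N ht]
  ring

/-! ### Reduction to log h and sufficiency -/

/-- `log h_{α,y}` as a function of `t = x + y + 1`, with `a = y + 1`. -/
noncomputable def logH (α a t : ℝ) : ℝ := -dslope (logGammaDefect α a) a t

theorem analyticOnNhd_logH (α : ℝ) {a : ℝ} (ha : 0 < a) :
    AnalyticOnNhd ℝ (logH α a) (Ioi 0) := fun t ht =>
  ((analyticOnNhd_logGammaDefect α a a ha).dslope (analyticOnNhd_logGammaDefect α a t ht)).neg

theorem logH_of_ne (α : ℝ) {a t : ℝ} (hta : t ≠ a) :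
    logH α a t
      = (Real.log (Real.Gamma t) - Real.log (Real.Gamma a)) / (t - a) - α * Real.log t := by
  have : t - a ≠ 0 := sub_ne_zero.2 hta
  rw [logH, dslope_of_ne _ hta, slope_def_field, logGammaDefect, logGammaDefect]
  field_simp
  ring

theorem logH_self (α : ℝ) {a : ℝ} (ha : 0 < a) :
    logH α a a = realPsi a - α * Real.log a := by
  have hG : DifferentiableAt ℝ Real.Gamma a :=
    (Real.differentiableOn_Gamma_Ioi a ha).differentiableAt (Ioi_mem_nhds ha)
  have h1 : HasDerivAt (logGammaDefect α a) (α * (1 * Real.log a + (a - a) * a⁻¹)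
      - deriv Real.Gamma a / Real.Gamma a) a :=
    HasDerivAt.sub ((((hasDerivAt_id a).sub_const a).mul
      (Real.hasDerivAt_log ha.ne')).const_mul α)
      (hG.hasDerivAt.log (Real.Gamma_pos_of_pos ha).ne')
  rw [logH, dslope_same, h1.deriv, realPsi]
  ring

theorem hFun_eq_exp_logH (α : ℝ) {y x : ℝ} (hy : -1 < y) (hx : x ∈ Ioi (-y - 1)) :
    hFun α y x = Real.exp (logH α (y + 1) (x + (y + 1))) := by
  have ha : 0 < y + 1 := by linarith
  have ht : 0 < x + y + 1 := by have : -y - 1 < x := hx; linarith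
  rw [hFun]
  split_ifs with h0
  · rw [h0, zero_add, logH_self α ha, sub_eq_neg_add, Real.exp_add, one_div,
      ← Real.rpow_neg ha.le, Real.rpow_def_of_pos ha]
    congr 2
    ring
  · have hG := Real.Gamma_pos_of_pos ht
    have hGa := Real.Gamma_pos_of_pos ha
    rw [logH_of_ne α (by simpa using h0), sub_eq_neg_add, Real.exp_add, one_div,
      ← Real.rpow_neg ht.le, Real.rpow_def_of_pos ht, Real.rpow_def_of_pos (div_pos hG hGa),
      Real.log_div hG.ne' hGa.ne', ← add_assoc]
    congr 2
    · ring
    · ring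

/-- Positivity and smoothness are automatic for the exponential of an analytic function, so only the
derivative signs remain. -/
theorem isLogCompletelyMonotonicOn_iff {f w : ℝ → ℝ} {a : ℝ} (hw : AnalyticOnNhd ℝ w (Ioi 0))
    (hf : ∀ x ∈ Ioi (-a), f x = Real.exp (w (x + a))) :
    IsLogCompletelyMonotonicOn f (Ioi (-a)) ↔
      ∀ k : ℕ, 1 ≤ k → ∀ t, 0 < t → 0 ≤ (-1 : ℝ) ^ k * iteratedDeriv k w t := by
  have hshift : ∀ x ∈ Ioi (-a), 0 < x + a := fun x hx => by
    have : -a < x := hx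
    linarith
  have hcomp : AnalyticOnNhd ℝ (fun x => w (x + a)) (Ioi (-a)) := fun x hx =>
    AnalyticAt.fun_comp (hw (x + a) (hshift x hx)) (analyticAt_id.add analyticAt_const)
  have hder : ∀ k : ℕ, ∀ x ∈ Ioi (-a),
      iteratedDerivWithin k (fun t => Real.log (f t)) (Ioi (-a)) x = iteratedDeriv k w (x + a) := by
    intro k x hx
    have hlog : EqOn (fun t => Real.log (f t)) (fun x => w (x + a)) (Ioi (-a)) := fun x hx => by
      simp only [hf x hx, Real.log_exp]
    rw [iteratedDerivWithin_congr hlog hx, iteratedDerivWithin_of_isOpen isOpen_Ioi hx,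
      iteratedDeriv_comp_add_const]
  constructor
  · intro h k hk t ht
    have hx : t - a ∈ Ioi (-a) := by simpa using ht
    have := h.2.2 k hk (t - a) hx
    rwa [hder k _ hx, sub_add_cancel] at this
  · refine fun h => ⟨fun x hx => hf x hx ▸ Real.exp_pos _, ?_, fun k hk x hx => ?_⟩
    · exact (ContDiffOn.exp fun x hx => (hcomp x hx).contDiffAt.contDiffWithinAt).congr hf
    · rw [hder k x hx]
      exact h k hk _ (hshift x hx)

theorem isLogCompletelyMonotonicOn_hFun_iff (α : ℝ) {y : ℝ} (hy : -1 < y) :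
    IsLogCompletelyMonotonicOn (hFun α y) (Ioi (-y - 1)) ↔
      ∀ k : ℕ, 1 ≤ k → ∀ t, 0 < t → 0 ≤ (-1 : ℝ) ^ k * iteratedDeriv k (logH α (y + 1)) t := by
  have e : -y - 1 = -(y + 1) := by ring
  rw [e]
  exact isLogCompletelyMonotonicOn_iff (analyticOnNhd_logH α (by linarith))
    fun x hx => hFun_eq_exp_logH α hy (e ▸ hx)

theorem isLogCompletelyMonotonicOn_one_div_hFun_iff (α : ℝ) {y : ℝ} (hy : -1 < y) :
    IsLogCompletelyMonotonicOn (fun x => 1 / hFun α y x) (Ioi (-y - 1)) ↔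
      ∀ k : ℕ, 1 ≤ k → ∀ t, 0 < t →
        0 ≤ (-1 : ℝ) ^ k * iteratedDeriv k (fun t => -logH α (y + 1) t) t := by
  have e : -y - 1 = -(y + 1) := by ring
  rw [e]
  refine isLogCompletelyMonotonicOn_iff (analyticOnNhd_logH α (by linarith)).neg fun x hx => ?_
  rw [hFun_eq_exp_logH α hy (e ▸ hx), Real.exp_neg, one_div]

theorem neg_one_pow_mul_iteratedDeriv_logH_nonneg {α a : ℝ} (ha : 0 < a) (h1 : 1 ≤ α)
    (h2 : 1 ≤ α * a) {k : ℕ} (hk : 1 ≤ k) {t : ℝ} (ht : 0 < t) :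
    0 ≤ (-1 : ℝ) ^ k * iteratedDeriv k (logH α a) t := by
  obtain ⟨k, rfl⟩ := Nat.exists_eq_add_of_le' hk
  have := iteratedDeriv_dslope_nonneg (analyticOnNhd_logGammaDefect α a) ha
    (fun t ht => neg_one_pow_mul_iteratedDeriv_logGammaDefect_nonneg 1
      (isCompletelyMonotonic_upper h1 h2) k ht) ht
  unfold logH
  rw [iteratedDeriv_fun_neg, pow_succ]
  linarith

theorem neg_one_pow_mul_iteratedDeriv_neg_logH_nonneg {α a : ℝ} (ha : 0 < a) (h1 : α ≤ 1)
    (h2 : α * a ≤ 1 / 2) {k : ℕ} (hk : 1 ≤ k) {t : ℝ} (ht : 0 < t) :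
    0 ≤ (-1 : ℝ) ^ k * iteratedDeriv k (fun t => -logH α a t) t := by
  obtain ⟨k, rfl⟩ := Nat.exists_eq_add_of_le' hk
  have := iteratedDeriv_dslope_nonneg (analyticOnNhd_logGammaDefect α a) ha
    (fun t ht => neg_one_pow_mul_iteratedDeriv_logGammaDefect_nonneg (-1)
      (isCompletelyMonotonic_lower h1 h2) k ht) ht
  simp only [logH, neg_neg]
  rw [pow_succ]
  exact this

/-! ### Necessity from asymptotics at infinity and at zero -/

theorem antitoneOn_of_neg_deriv_nonneg {w : ℝ → ℝ} (hw : AnalyticOnNhd ℝ w (Ioi 0))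
    (h : ∀ k : ℕ, 1 ≤ k → ∀ t, 0 < t → 0 ≤ (-1 : ℝ) ^ k * iteratedDeriv k w t) :
    AntitoneOn w (Ioi 0) := by
  refine antitoneOn_of_deriv_nonpos (convex_Ioi 0) hw.continuousOn
    (hw.differentiableOn.mono interior_subset) fun t ht => ?_
  have := h 1 le_rfl t (interior_subset ht)
  simpa using this

theorem tendsto_log_factorial_div :
    Tendsto (fun n : ℕ => Real.log n.factorial / (n * Real.log n)) atTop (𝓝 1) := by
  have hlog : Tendsto (fun n : ℕ => Real.log n) atTop atTop :=
    Real.tendsto_log_atTop.comp tendsto_natCast_atTop_atTop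
  have hlow : Tendsto (fun n : ℕ => 1 - (Real.log n)⁻¹) atTop (𝓝 1) := by
    simpa using (tendsto_const_nhds (x := (1 : ℝ))).sub hlog.inv_tendsto_atTop
  refine tendsto_of_tendsto_of_tendsto_of_le_of_le' hlow tendsto_const_nhds ?_ ?_
  · filter_upwards [eventually_gt_atTop 1] with n hn
    have hn' : (1 : ℝ) < n := Nat.one_lt_cast.2 hn
    have hl := Real.log_pos hn'
    have hpi : 0 ≤ Real.log (2 * Real.pi) := Real.log_nonneg (by linarith [Real.pi_gt_three])
    have := Stirling.le_log_factorial_stirling (n := n) (by omega)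
    rw [le_div_iff₀ (by positivity)]
    -- The bound used is `n log n - n ≤ log n!`, Stirling with its nonnegative terms dropped.
    have e : (1 - (Real.log n)⁻¹) * (n * Real.log n) = n * Real.log n - n := by field_simp
    linarith
  · filter_upwards [eventually_gt_atTop 1] with n hn
    have hn' : (1 : ℝ) < n := Nat.one_lt_cast.2 hn
    have hl := Real.log_pos hn'
    rw [div_le_one (by positivity), ← Real.log_pow]
    exact Real.log_le_log (by positivity) (mod_cast Nat.factorial_le_pow n)

theorem tendsto_logH_natCast_div_log (α a : ℝ) :
    Tendsto (fun n : ℕ => logH α a (n + 1) / Real.log n) atTop (𝓝 (1 - α)) := by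
  have hlog : Tendsto (fun n : ℕ => Real.log n) atTop atTop :=
    Real.tendsto_log_atTop.comp tendsto_natCast_atTop_atTop
  have hn : Tendsto (fun n : ℕ => (n : ℝ) + (1 - a)) atTop atTop :=
    tendsto_atTop_add_const_right _ _ tendsto_natCast_atTop_atTop
  have hratio : Tendsto (fun n : ℕ => (n : ℝ) / (n + (1 - a))) atTop (𝓝 1) :=
    tendsto_natCast_div_add_atTop (1 - a)
  have hlogratio : Tendsto (fun n : ℕ => Real.log (n + 1) / Real.log n) atTop (𝓝 1) := by
    have := (Real.tendsto_log_nat_add_one_sub_log.mul hlog.inv_tendsto_atTop).add_const 1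
    rw [zero_mul, zero_add] at this
    refine this.congr' ?_
    filter_upwards [hlog.eventually_gt_atTop 0] with n hn
    simp only [Pi.inv_apply]
    field_simp
    ring
  have hconst : Tendsto (fun n : ℕ => Real.log (Real.Gamma a) * ((n : ℝ) + (1 - a))⁻¹
      * (Real.log n)⁻¹) atTop (𝓝 0) := by
    simpa using (hn.inv_tendsto_atTop.const_mul (Real.log (Real.Gamma a))).mul
      hlog.inv_tendsto_atTop
  have := ((tendsto_log_factorial_div.mul hratio).sub hconst).sub (hlogratio.const_mul α)
  rw [mul_one, sub_zero, mul_one] at this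
  refine this.congr' ?_
  filter_upwards [hlog.eventually_gt_atTop 0, hn.eventually_gt_atTop 0, eventually_gt_atTop 0]
    with n h1 h2 h3
  have h3' : (0 : ℝ) < n := Nat.cast_pos.2 h3
  rw [logH_of_ne α (by intro h; linarith), Real.Gamma_nat_eq_factorial]
  have e : (n : ℝ) + 1 - a = n + (1 - a) := by ring
  rw [e]
  field_simp

/-- Writing `log Γ(t) = log Γ(t + 1) - log t` isolates the singular part `log t / (a - t)`; the rest
of the difference quotient stays bounded near `0`. -/
theorem tendsto_logH_div_log_nhdsGT_zero (α : ℝ) {a : ℝ} (ha : 0 < a) :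
    Tendsto (fun t => logH α a t / Real.log t) (𝓝[>] 0) (𝓝 (1 / a - α)) := by
  have hinv : Tendsto (fun t => (Real.log t)⁻¹) (𝓝[>] 0) (𝓝 0) :=
    Real.tendsto_log_nhdsGT_zero.inv_tendsto_atBot
  have hcont : Tendsto (fun t => (Real.log (Real.Gamma (t + 1)) - Real.log (Real.Gamma a))
      / (t - a)) (𝓝[>] 0) (𝓝 ((Real.log (Real.Gamma (0 + 1)) - Real.log (Real.Gamma a))
      / (0 - a))) := by
    have hG : ContinuousAt (fun t => Real.log (Real.Gamma t)) (0 + 1) :=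
      (analyticOnNhd_log_Gamma _ (by simp)).continuousAt
    have : ContinuousAt (fun t => (Real.log (Real.Gamma (t + 1)) - Real.log (Real.Gamma a))
        / (t - a)) 0 :=
      ((hG.comp (f := fun t : ℝ => t + 1) (by fun_prop)).sub continuousAt_const).div
        (by fun_prop) (by simpa using ha.ne')
    exact this.tendsto.mono_left nhdsWithin_le_nhds
  have hfrac : Tendsto (fun t => 1 / (a - t)) (𝓝[>] 0) (𝓝 (1 / a)) := by
    have : ContinuousAt (fun t => 1 / (a - t)) 0 :=
      continuousAt_const.div (by fun_prop) (by simpa using ha.ne')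
    simpa using this.tendsto.mono_left (nhdsWithin_le_nhds (s := Ioi 0))
  have := ((hcont.mul hinv).add hfrac).sub_const α
  rw [mul_zero, zero_add] at this
  refine this.congr' ?_
  filter_upwards [Ioo_mem_nhdsGT (lt_min ha one_pos)] with t ht
  have ht0 : 0 < t := ht.1
  have hta : t < a := ht.2.trans_le (min_le_left _ _)
  have hl : Real.log t ≠ 0 := (Real.log_neg ht0 (ht.2.trans_le (min_le_right _ _))).ne
  rw [logH_of_ne α hta.ne, Real.Gamma_add_one ht0.ne',
    Real.log_mul ht0.ne' (Real.Gamma_pos_of_pos ht0).ne']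
  have h1 : t - a ≠ 0 := (sub_neg.2 hta).ne
  have h2 : a - t = -(t - a) := by ring
  rw [h2]
  field_simp
  ring

/-- Comparison with the fixed value at `1`, which is negligible after division by `log n`. -/
theorem one_le_of_antitoneOn_logH {α a : ℝ} (h : AntitoneOn (logH α a) (Ioi 0)) : 1 ≤ α := by
  have hlog : Tendsto (fun n : ℕ => Real.log n) atTop atTop :=
    Real.tendsto_log_atTop.comp tendsto_natCast_atTop_atTop
  have h0 : Tendsto (fun n : ℕ => logH α a 1 / Real.log n) atTop (𝓝 0) := hlog.const_div_atTop _
  have := le_of_tendsto_of_tendsto (tendsto_logH_natCast_div_log α a) h0 (by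
    filter_upwards [hlog.eventually_gt_atTop 0] with n hn
    exact div_le_div_of_nonneg_right (h (show (0 : ℝ) < 1 by norm_num)
      (show (0 : ℝ) < n + 1 by positivity) (by simp)) hn.le)
  linarith

theorem le_one_of_antitoneOn_neg_logH {α a : ℝ}
    (h : AntitoneOn (fun t => -logH α a t) (Ioi 0)) : α ≤ 1 := by
  have hlog : Tendsto (fun n : ℕ => Real.log n) atTop atTop :=
    Real.tendsto_log_atTop.comp tendsto_natCast_atTop_atTop
  have h0 : Tendsto (fun n : ℕ => logH α a 1 / Real.log n) atTop (𝓝 0) := hlog.const_div_atTop _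
  have := le_of_tendsto_of_tendsto h0 (tendsto_logH_natCast_div_log α a) (by
    filter_upwards [hlog.eventually_gt_atTop 0] with n hn
    exact div_le_div_of_nonneg_right (neg_le_neg_iff.1 (h (show (0 : ℝ) < 1 by norm_num)
      (show (0 : ℝ) < n + 1 by positivity) (by simp))) hn.le)
  linarith

theorem one_div_le_of_antitoneOn_logH {α a : ℝ} (ha : 0 < a)
    (h : AntitoneOn (logH α a) (Ioi 0)) : 1 / a ≤ α := by
  have h0 : Tendsto (fun t => logH α a 1 / Real.log t) (𝓝[>] 0) (𝓝 0) :=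
    Real.tendsto_log_nhdsGT_zero.const_div_atBot _
  have := le_of_tendsto_of_tendsto (tendsto_logH_div_log_nhdsGT_zero α ha) h0 (by
    filter_upwards [Ioo_mem_nhdsGT one_pos] with t ht
    -- Near `0` the divisor `log t` is negative, so the inequality from antitonicity is reversed.
    exact div_le_div_of_nonpos_of_le (Real.log_neg ht.1 ht.2).le
      (h ht.1 (show (0 : ℝ) < 1 by norm_num) ht.2.le))
  linarith

theorem theorem1 (y : ℝ) (hy : -1 < y) (α : ℝ) :
    (IsLogCompletelyMonotonicOn (hFun α y) (Set.Ioi (-y - 1)) ↔ max 1 (1 / (y + 1)) ≤ α) ∧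
    (α ≤ min 1 (1 / (2 * (y + 1))) →
      IsLogCompletelyMonotonicOn (fun x => 1 / hFun α y x) (Set.Ioi (-y - 1))) ∧
    (IsLogCompletelyMonotonicOn (fun x => 1 / hFun α y x) (Set.Ioi (-y - 1)) → α ≤ 1) := by
  have ha : 0 < y + 1 := by linarith
  have hw := analyticOnNhd_logH α ha
  rw [isLogCompletelyMonotonicOn_hFun_iff α hy, isLogCompletelyMonotonicOn_one_div_hFun_iff α hy]
  refine ⟨⟨fun h => ?_, fun h k hk t ht => ?_⟩, fun h k hk t ht => ?_, fun h => ?_⟩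
  · have hanti := antitoneOn_of_neg_deriv_nonneg hw h
    exact max_le (one_le_of_antitoneOn_logH hanti) (one_div_le_of_antitoneOn_logH ha hanti)
  · have h2 := (le_max_right _ _).trans h
    rw [div_le_iff₀ ha] at h2
    exact neg_one_pow_mul_iteratedDeriv_logH_nonneg ha ((le_max_left _ _).trans h) h2 hk ht
  · have h2 := h.trans (min_le_right _ _)
    rw [le_div_iff₀ (by positivity)] at h2
    exact neg_one_pow_mul_iteratedDeriv_neg_logH_nonneg ha (h.trans (min_le_left _ _))
      (by linarith) hk ht
  · exact le_one_of_antitoneOn_neg_logH (antitoneOn_of_neg_deriv_nonneg hw.neg h)
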